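/- **Definitions.** A *cell complex* (cc) is a collection $K$ of non-empty subsets (*cells*) of a finite set $S$ with a rank function $\mathrm{rk}:K\to\mathbb N$ whose rank-$0$ cells are exactly the singletons of $S$, such that: (i) $x\subsetneq y$ implies $\mathrm{rk}(x)<\mathrm{rk}(y)$; (ii) the intersection of two cells is a cell or empty; (iii) if $x\subsetneq y$ are cells, there is a cell $z$ with $x\subset z\subset y$ and $\mathrm{rk}(z)=\mathrm{rk}(x)+1$; (iv) if $x\subset y$ are cells with $\mathrm{rk}(y)=\mathrm{rk}(x)+2$, there are exactly two cells $z$ with $x\subset z\subset y$ and $\mathrm{rk}(z)=\mathrm{rk}(x)+1$. $K^{[r]}$ denotes the set of cells of rank $r$ (the elements of $K^{[0]}$, $K^{[1]}$ are the *vertices*, identified with the elements of $S$, and the *edges*), the *rank* of $K$ is the least $R$ such that all cells have rank $\le R$, and a *2-cc* is a cc of rank $2$. A cc $J$ is a *sub-cc* of $K$, $J\le K$, if $J\subset K$ and $\mathrm{rk}_J=\mathrm{rk}_K|_J$; $J\lneq K$ means $J\le K$ and $J\ne K$. For a set $A$ of vertices, $K\cap A:=\{x\in K: x\subset A\}$ is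 a cc. For a vertex $v$ put $\mathcal E_v:=\{e\in K^{[1]}: v\in e\}$ and $\mathcal E_v^C:=\{e\in\mathcal E_v: e\subset C\}$. $K$ is *graph-based* if each edge has exactly two vertices; its vertices and edges then form a graph. $K$ is *connected* if it is graph-based and this graph is connected; *local* if it is connected and $K\cap x$ is connected for each cell $x$; *$n$-regular* if it is graph-based and $|\mathcal E_v|=n$ for all vertices $v$; *even* if each connected component of each 2-cell has an even number of vertices; *full* if it has rank at least $2$ and for every vertex $v$ and every $S\subset\mathcal E_v$ with $|S|=2$ there is a 2-cell $C$ with $\mathcal E_v^C=S$. In a full graph-based $K$, an edge $\{v,w\}$ induces a bijection $\nabla^v_w:\mathcal E_v\to\mathcal E_w$: it fixes $\{v,w\}$, and sends any other $e\in\mathcal E_v$ to the edge at $w$ other than $\{v,w\}$ in the unique 2-cell containing $e$ and $\{v,w\}$. For a path $p$, $\nabla_p$ is the composite of these maps along $p$. $K$ is *monodromy-free* if for each connected component $C$ of a 2-cell and each $v\in C$, the map $\nabla_l$ of a loop $l$ based at $v$ running once around $C$ fixes every edge at $v$ having exactly one vertex in $C$. Two paths with the same endpoints are *homotopic* if they are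 related by finitely many of the following moves and their inverses: deleting a subpath that traverses an edge back and forth; replacing a subpath $p$ that is a simple path in a 2-cell $C$ by the path $p'$ in $C$ with the same endpoints such that $p$ followed by the inverse of $p'$ is a loop running once around a component of $C$. $K$ is *simply connected* if it is graph-based and each closed path is homotopic to the empty path. **Theorem.** Let $K$ be a local, even, full, monodromy-free, simply connected 2-cc. Then for every vertex $v$ and every $S_v\subsetneq\mathcal E_v$ with $r:=|S_v|\ge 2$ there is a unique sub-cc $J(v,S_v)$ of $K$ that is an $r$-regular, local, even, full, monodromy-free, connected 2-cc and satisfies $$J(v,S_v)^{[1]}\cap\mathcal E_v=S_v .$$ Moreover, for all such pairs $(v,S_v)$, $(v',S'_{v'})$ and $(v,S'_v)$: 1. $J(v,S_v)=J(v',S'_{v'})$ if and only if $v'\in J(v,S_v)^{[0]}$ and $S'_{v'}=J(v,S_v)^{[1]}\cap\mathcal E_{v'}$; 2. $S_v\subsetneq S'_v$ if and only if $J(v,S_v)\lneq J(v,S'_v)$; 3. if $|S_v|=2$, then $S_v=\mathcal E_v^C$ for some $C\in K^{[2]}$, and $J(v,S_v)=K\cap C$. -/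

import Mathlib

/-- A (combinatorial) cell complex: a finite set `verts`, a family `cells` of non-empty subsets
of `verts` and a rank function whose rank-zero cells are exactly the singletons of `verts`,
subject to the four axioms of a cell complex.  The value of `rk` off `cells` is irrelevant and
normalised to `0`, so that two complexes with the same cells and ranks are equal. -/
@[ext]
structure CellComplex (V : Type*) where
  verts : Set V
  cells : Set (Set V)
  rk : Set V → ℕ
  finite_verts : verts.Finite
  cell_subset : ∀ x ∈ cells, x ⊆ verts
  cell_nonempty : ∀ x ∈ cells, x.Nonempty
  rk_eq_zero_iff : ∀ x, (x ∈ cells ∧ rk x = 0) ↔ ∃ v ∈ verts, x = {v}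
  rk_off : ∀ x, x ∉ cells → rk x = 0
  /-- the rank is strictly monotone -/
  rk_lt : ∀ x ∈ cells, ∀ y ∈ cells, x ⊂ y → rk x < rk y
  /-- closure under non-empty intersections -/
  inter_mem : ∀ x ∈ cells, ∀ y ∈ cells, x ∩ y ∈ cells ∨ x ∩ y = ∅
  /-- no gap in the rank: if `x` is strictly below `y`, then `x` is a face of a cell below `y` -/
  exists_coface : ∀ x ∈ cells, ∀ y ∈ cells, x ⊂ y →
    ∃ z ∈ cells, x ⊆ z ∧ z ⊆ y ∧ rk z = rk x + 1
  /-- the diamond property: exactly two cells are both a co-face of `x` and a face of `y` -/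
  diamond : ∀ x ∈ cells, ∀ y ∈ cells, x ⊆ y → rk y = rk x + 2 →
    {z | z ∈ cells ∧ x ⊆ z ∧ z ⊆ y ∧ rk z = rk x + 1}.ncard = 2

namespace CellComplex

variable {V : Type*}

/-- `J ≤ K`: `J` is a sub-cell complex of `K`. -/
instance : LE (CellComplex V) where
  le J K := J.cells ⊆ K.cells ∧ ∀ x ∈ J.cells, J.rk x = K.rk x

/-- The set of cells of rank `r`. -/
def skel (K : CellComplex V) (r : ℕ) : Set (Set V) := {x | x ∈ K.cells ∧ K.rk x = r}

/-- The rank (dimension) of `K`: the least `R` such that all cells have rank at most `R`. -/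
noncomputable def dim (K : CellComplex V) : ℕ := sInf {R | ∀ x ∈ K.cells, K.rk x ≤ R}

open Classical in
/-- The restriction of `K` to a set `A` of vertices: the cells of `K` contained in `A`. -/
noncomputable def restrict (K : CellComplex V) (A : Set V) : CellComplex V where
  verts := K.verts ∩ A
  cells := {x | x ∈ K.cells ∧ x ⊆ A}
  rk x := if x ∈ K.cells ∧ x ⊆ A then K.rk x else 0
  finite_verts := K.finite_verts.subset Set.inter_subset_left
  cell_subset x hx := Set.subset_inter (K.cell_subset x hx.1) hx.2
  cell_nonempty x hx := K.cell_nonempty x hx.1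
  rk_eq_zero_iff x := by
    constructor
    · rintro ⟨hx, h0⟩
      have hx' : x ∈ K.cells ∧ x ⊆ A := hx
      rw [if_pos hx'] at h0
      obtain ⟨v, hv, rfl⟩ := (K.rk_eq_zero_iff x).1 ⟨hx.1, h0⟩
      exact ⟨v, ⟨hv, hx.2 rfl⟩, rfl⟩
    · rintro ⟨v, ⟨hv, hvA⟩, rfl⟩
      have h := (K.rk_eq_zero_iff {v}).2 ⟨v, hv, rfl⟩
      have hA : ({v} : Set V) ⊆ A := Set.singleton_subset_iff.2 hvA
      have hc : ({v} : Set V) ∈ K.cells ∧ ({v} : Set V) ⊆ A := ⟨h.1, hA⟩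
      exact ⟨hc, by rw [if_pos hc]; exact h.2⟩
  rk_off x hx := if_neg hx
  rk_lt x hx y hy h := by
    have hx' : x ∈ K.cells ∧ x ⊆ A := hx
    have hy' : y ∈ K.cells ∧ y ⊆ A := hy
    rw [if_pos hx', if_pos hy']
    exact K.rk_lt x hx.1 y hy.1 h
  inter_mem x hx y hy := (K.inter_mem x hx.1 y hy.1).imp
    (fun h => ⟨h, Set.inter_subset_left.trans hx.2⟩) id
  exists_coface x hx y hy h := by
    obtain ⟨z, hz, hxz, hzy, hr⟩ := K.exists_coface x hx.1 y hy.1 h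
    have hx' : x ∈ K.cells ∧ x ⊆ A := hx
    have hz' : z ∈ K.cells ∧ z ⊆ A := ⟨hz, hzy.trans hy.2⟩
    refine ⟨z, hz', hxz, hzy, ?_⟩
    rw [if_pos hx', if_pos hz']
    exact hr
  diamond x hx y hy h hr := by
    have hx' : x ∈ K.cells ∧ x ⊆ A := hx
    have hy' : y ∈ K.cells ∧ y ⊆ A := hy
    rw [if_pos hx', if_pos hy'] at hr
    rw [← K.diamond x hx.1 y hy.1 h hr, if_pos hx']
    congr 1
    ext z
    constructor
    · rintro ⟨hz, h1, h2, h3⟩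
      have hz' : z ∈ K.cells ∧ z ⊆ A := hz
      rw [if_pos hz'] at h3
      exact ⟨hz.1, h1, h2, h3⟩
    · rintro ⟨hz, h1, h2, h3⟩
      have hz' : z ∈ K.cells ∧ z ⊆ A := ⟨hz, h2.trans hy.2⟩
      exact ⟨hz', h1, h2, by rw [if_pos hz']; exact h3⟩

/-- Every edge (1-cell) has exactly two vertices. -/
def IsGraphBased (K : CellComplex V) : Prop := ∀ e ∈ K.skel 1, e.ncard = 2

/-- The 1-skeleton as a graph (points of `V` that are not vertices of `K` are isolated). -/
def graph (K : CellComplex V) : SimpleGraph V where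
  Adj v w := v ≠ w ∧ {v, w} ∈ K.skel 1
  symm := ⟨fun v w h => ⟨h.1.symm, by rw [Set.pair_comm]; exact h.2⟩⟩
  loopless := ⟨fun _ h => h.1 rfl⟩

/-- `K` is graph-based and any two of its vertices are joined by a path in the 1-skeleton. -/
def IsConnected (K : CellComplex V) : Prop :=
  K.IsGraphBased ∧ ∀ v ∈ K.verts, ∀ w ∈ K.verts, K.graph.Reachable v w

/-- `K` is graph-based and the complex underlying each cell is connected. -/
def IsCellConnected (K : CellComplex V) : Prop :=
  K.IsGraphBased ∧ ∀ x ∈ K.cells, (K.restrict x).IsConnected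

/-- Local cell complexes: connected and cell-connected. -/
def IsLocal (K : CellComplex V) : Prop := K.IsConnected ∧ K.IsCellConnected

/-- The set of edges of `K` incident to `v`. -/
def edgesAt (K : CellComplex V) (v : V) : Set (Set V) := {e | e ∈ K.skel 1 ∧ v ∈ e}

/-- The set of edges of `K` incident to `v` and contained in `x`. -/
def edgesAtIn (K : CellComplex V) (v : V) (x : Set V) : Set (Set V) :=
  {e | e ∈ K.edgesAt v ∧ e ⊆ x}

/-- `K` is graph-based and every vertex has exactly `n` incident edges. -/
def IsRegular (K : CellComplex V) (n : ℕ) : Prop :=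
  K.IsGraphBased ∧ ∀ v ∈ K.verts, (K.edgesAt v).ncard = n

/-- `K` has rank at least 2, and any two distinct edges at a vertex `v` are exactly the edges at
`v` of some 2-cell. -/
def IsFull (K : CellComplex V) : Prop :=
  2 ≤ K.dim ∧ ∀ v ∈ K.verts, ∀ S ⊆ K.edgesAt v, S.ncard = 2 →
    ∃ C ∈ K.skel 2, K.edgesAtIn v C = S

/-- The connected component containing `v` of a cell `C ∋ v`: the endpoints of the paths in the
1-skeleton that start at `v` and stay in `C`. -/
def component (K : CellComplex V) (C : Set V) (v : V) : Set V :=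
  {w | ∃ p : K.graph.Walk v w, ∀ u ∈ p.support, u ∈ C}

/-- Every connected component of every 2-cell has an even number of vertices. -/
def IsEven (K : CellComplex V) : Prop :=
  ∀ C ∈ K.skel 2, ∀ v ∈ C, Even (K.component C v).ncard

/-- `l` is a loop based at `v` that stays in `C`.  When `C` is a 2-cell, every vertex of `C` has
exactly two neighbours in `C`, so such an `l` is one of the two loops that run once around the
connected component of `C` containing `v`. -/
def IsCellLoop (K : CellComplex V) (C : Set V) {v : V} (l : K.graph.Walk v v) : Prop :=
  l.IsCycle ∧ ∀ u ∈ l.support, u ∈ C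

/-- The (graph of the) connection along an edge `{v, w}`: it sends `{v, w}` to itself, and any
other edge `e` at `v` to the other edge at `w` in the 2-cell containing `e` and `{v, w}`. -/
def Nabla (K : CellComplex V) (v w : V) (e e' : Set V) : Prop :=
  e ∈ K.edgesAt v ∧ e' ∈ K.edgesAt w ∧
    ((e = {v, w} ∧ e' = {v, w}) ∨
      (e ≠ {v, w} ∧ e' ≠ {v, w} ∧ ∃ C ∈ K.skel 2, {v, w} ⊆ C ∧ e ⊆ C ∧ e' ⊆ C))

lemma ncard_edgesAtIn (K : CellComplex V) {C : Set V} (hC : C ∈ K.skel 2) {v : V} (hv : v ∈ C) :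
    (K.edgesAtIn v C).ncard = 2 := by
  have hvv := K.cell_subset C hC.1 hv
  have h := (K.rk_eq_zero_iff {v}).2 ⟨v, hvv, rfl⟩
  rw [← K.diamond {v} h.1 C hC.1 (Set.singleton_subset_iff.2 hv) (by rw [hC.2, h.2])]
  congr 1; ext z
  simp [edgesAtIn, edgesAt, skel, h.2]; tauto

lemma eq_of_two (K : CellComplex V) {C D : Set V} (hC : C ∈ K.skel 2) (hD : D ∈ K.skel 2)
    {e f : Set V} (he : e ∈ K.skel 1) (hf : f ∈ K.skel 1) (hne : e ≠ f) (h1 : e ⊆ C) (h2 : f ⊆ C)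
    (h3 : e ⊆ D) (h4 : f ⊆ D) : C = D := by
  have hI : C ∩ D ∈ K.cells := by
    rcases K.inter_mem C hC.1 D hD.1 with h | h
    · exact h
    · obtain ⟨x, hx⟩ := K.cell_nonempty e he.1
      have : x ∈ C ∩ D := ⟨h1 hx, h3 hx⟩
      simp [h] at this
  have hr : 2 ≤ K.rk (C ∩ D) := by
    by_contra hlt
    have k : ∀ g ∈ K.skel 1, g ⊆ C ∩ D → g = C ∩ D := fun g hg hs => by
      by_contra hh
      have := K.rk_lt g hg.1 _ hI (hs.ssubset_of_ne hh)
      have := hg.2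
      omega
    exact hne ((k e he (Set.subset_inter h1 h3)).trans (k f hf (Set.subset_inter h2 h4)).symm)
  have k : ∀ g ∈ K.skel 2, C ∩ D ⊆ g → C ∩ D = g := fun g hg hs => by
      by_contra hh
      have := K.rk_lt _ hI g hg.1 (hs.ssubset_of_ne hh)
      have := hg.2
      omega
  exact (k C hC Set.inter_subset_left).symm.trans (k D hD Set.inter_subset_right)

/-- In a full complex the connection along an edge is a well-defined map. -/
theorem existsUnique_nabla (K : CellComplex V) (hK : K.IsFull) {v w : V} (h : K.graph.Adj v w)
    {e : Set V} (he : e ∈ K.edgesAt v) : ∃! e', K.Nabla v w e e' := by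
  have hvw : ({v, w} : Set V) ∈ K.edgesAt v := ⟨h.2, by simp⟩
  have hwv : ({v, w} : Set V) ∈ K.edgesAt w := ⟨h.2, by simp⟩
  by_cases hev : e = {v, w}
  · exact ⟨{v, w}, ⟨he, hwv, .inl ⟨hev, rfl⟩⟩, fun f hf => by
      rcases hf.2.2 with h | h
      · exact h.2
      · exact absurd hev h.1⟩
  · obtain ⟨C, hC, hCe⟩ := hK.2 v (K.cell_subset _ h.2.1 (by simp)) {e, {v, w}}
      (by rintro x (rfl | rfl) <;> assumption) (Set.ncard_pair hev)
    have h1 : e ⊆ C := (hCe.symm ▸ (by simp) : e ∈ K.edgesAtIn v C).2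
    have h2 : {v, w} ⊆ C := (hCe.symm ▸ (by simp) : {v, w} ∈ K.edgesAtIn v C).2
    have hw := K.ncard_edgesAtIn hC (h2 (by simp : w ∈ ({v, w} : Set V)))
    have hm : ({v, w} : Set V) ∈ K.edgesAtIn w C := ⟨hwv, h2⟩
    obtain ⟨a, ha, hab⟩ := Set.exists_ne_of_one_lt_ncard (by omega : 1 < (K.edgesAtIn w C).ncard) {v, w}
    refine ⟨a, ⟨he, ha.1, .inr ⟨hev, hab, C, hC, h2, h1, ha.2⟩⟩, ?_⟩
    rintro f ⟨_, hf, h | ⟨_, hf2, D, hD, k1, k2, k3⟩⟩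
    · exact absurd h.1 hev
    obtain rfl := K.eq_of_two hC hD he.1 h.2 hev h1 h2 k2 k1
    by_contra hfa
    have : ({f, a, {v, w}} : Set (Set V)).ncard = 3 := by
      rw [Set.ncard_eq_three]; exact ⟨_, _, _, hfa, hf2, hab, rfl⟩
    have hle := Set.ncard_le_ncard (s := {f, a, {v, w}}) (t := K.edgesAtIn w C)
      (by rintro x (rfl | rfl | rfl); exacts [⟨hf, k3⟩, ha, hm]) (Set.finite_of_ncard_ne_zero (by omega))
    omega

/-- The (graph of the) connection along a path: the composite of the connections along its
edges. -/
def NablaPath (K : CellComplex V) : ∀ {v w : V}, K.graph.Walk v w → Set V → Set V → Prop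
  | _, _, .nil, e, e' => e = e'
  | v, _, .cons (v := u) _ p, e, e' => ∃ f, K.Nabla v u e f ∧ NablaPath K p f e'

/-- For every 2-cell `C` and every vertex `v` of `C`, the connection along a loop around the
component of `C` at `v` fixes every edge at `v` having exactly one vertex in that component. -/
def IsMonodromyFree (K : CellComplex V) : Prop :=
  ∀ C ∈ K.skel 2, ∀ v ∈ C, ∀ l : K.graph.Walk v v, K.IsCellLoop C l →
    ∀ e ∈ K.edgesAt v, (e ∩ K.component C v).ncard = 1 → K.NablaPath l e e

/-- Elementary moves of paths: removing a back-and-forth passage through an edge, and replacing a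
simple path `p` in a 2-cell `C` by its complementary path `p'`, the path with the same endpoints
such that `p` followed by the inverse of `p'` is a loop around (a component of) `C`. -/
inductive Move (K : CellComplex V) : ∀ {a b : V}, K.graph.Walk a b → K.graph.Walk a b → Prop
  | edge {a b v w : V} (q₁ : K.graph.Walk a v) (h : K.graph.Adj v w) (q₂ : K.graph.Walk v b) :
      Move K (q₁.append (.cons h (.cons h.symm q₂))) (q₁.append q₂)
  | cell {a b v w : V} (q₁ : K.graph.Walk a v) (p p' : K.graph.Walk v w) (q₂ : K.graph.Walk w b)
      (C : Set V) (hC : C ∈ K.skel 2) (hp : p.IsPath)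
      (hl : K.IsCellLoop C (p.append p'.reverse)) :
      Move K (q₁.append (p.append q₂)) (q₁.append (p'.append q₂))

/-- Paths with the same endpoints are homotopic if they are related by finitely many moves and
inverses of moves. -/
def Homotopic (K : CellComplex V) {a b : V} (p q : K.graph.Walk a b) : Prop :=
  Relation.EqvGen (Move K) p q

/-- `K` is graph-based and every closed path is homotopic to the empty path. -/
def IsSimplyConnected (K : CellComplex V) : Prop :=
  K.IsGraphBased ∧ ∀ (v : V) (p : K.graph.Walk v v), K.Homotopic p .nil

/-- The pairs `(v, S)` of a vertex `v` and a proper subset `S` of the edges at `v` with at least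
two elements. -/
def Admissible (K : CellComplex V) (v : V) (S : Set (Set V)) : Prop :=
  v ∈ K.verts ∧ S ⊂ K.edgesAt v ∧ 2 ≤ S.ncard

/-- `J` is a sub-cell complex of `K` that is an `|S|`-regular local even full monodromy-free
connected 2-cell complex whose edges at `v` are exactly those in `S`. -/
def IsInduced (K : CellComplex V) (v : V) (S : Set (Set V)) (J : CellComplex V) : Prop :=
  J ≤ K ∧ J.dim = 2 ∧ J.IsRegular S.ncard ∧ J.IsLocal ∧ J.IsEven ∧ J.IsFull ∧
    J.IsMonodromyFree ∧ J.IsConnected ∧ J.skel 1 ∩ K.edgesAt v = S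

end CellComplex

namespace CellComplex

variable {V : Type*} {J K : CellComplex V}

/-! The maps ∇ act as a parallel transport of edges, and the hypotheses make it flat. Around a
2-cell, an edge inside the cell returns to itself because the transport alternates between the two
edges of the cell at each vertex and the number of steps is even; an edge leaving the cell returns
by monodromy-freeness (`nablaPath_cellLoop`). So transport is invariant under homotopy, and by
simple connectedness it depends only on the endpoints of a path (`nablaPath_closed_eq`).

Existence: `S` at `v` therefore spreads to `|S|` edges at every vertex (`transported`,
`ncard_transported`), compatibly with ∇. The vertices reachable through these edges, with all cells
whose edges are all transported, form `span`. It is full because two transported edges at a vertex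
lie in a 2-cell of `K`, and transport inside that cell shows that all its edges are transported
(`mem_span_of_edgesAtIn_subset`). Evenness and monodromy-freeness pass to it because it contains
every cell of `K` below one of its own (`IsLower.isInduced`).

Uniqueness: the connection of a full subcomplex is the restriction of that of `K`, so the edges at
one vertex determine those at its neighbours, hence by connectedness all edges, and two edges at a
vertex determine a 2-cell. The resulting comparison `cells_subset_of_edgesAt_subset` yields
uniqueness and claims 1 and 2; claim 3 is uniqueness applied to `isInduced_restrict`. -/

/-! ### Vertices and edges -/

lemma singleton_mem_cells_iff {v : V} : {v} ∈ K.cells ↔ v ∈ K.verts := by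
  constructor
  · intro h
    exact K.cell_subset _ h rfl
  · intro h
    exact ((K.rk_eq_zero_iff {v}).2 ⟨v, h, rfl⟩).1

lemma mem_verts_of_mem_edgesAt {v : V} {e : Set V} (he : e ∈ K.edgesAt v) : v ∈ K.verts :=
  K.cell_subset e he.1.1 he.2

lemma skel_one_eq_of_subset {e f : Set V} (he : e ∈ K.skel 1) (hf : f ∈ K.skel 1) (h : e ⊆ f) :
    e = f := by
  by_contra hne
  have h1 := K.rk_lt e he.1 f hf.1 (h.ssubset_of_ne hne)
  rw [he.2, hf.2] at h1
  exact lt_irrefl _ h1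

lemma IsGraphBased.exists_adj (hK : K.IsGraphBased) {v : V} {e : Set V} (he : e ∈ K.edgesAt v) :
    ∃ w, K.graph.Adj v w ∧ e = {v, w} := by
  obtain ⟨a, b, hab, rfl⟩ := Set.ncard_eq_two.1 (hK e he.1)
  rcases he.2 with rfl | h
  · exact ⟨b, ⟨hab, he.1⟩, rfl⟩
  · obtain rfl : v = b := h
    refine ⟨a, ⟨hab.symm, ?_⟩, Set.pair_comm _ _⟩
    rw [Set.pair_comm]
    exact he.1

lemma graph_adj_mem_edgesAt_left {v w : V} (h : K.graph.Adj v w) : {v, w} ∈ K.edgesAt v :=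
  ⟨h.2, by simp⟩

lemma graph_adj_mem_edgesAt_right {v w : V} (h : K.graph.Adj v w) : {v, w} ∈ K.edgesAt w :=
  ⟨h.2, by simp⟩

lemma finite_edgesAt (v : V) : (K.edgesAt v).Finite :=
  K.finite_verts.finite_subsets.subset fun e he => K.cell_subset e he.1.1

/-! ### Subcomplexes -/

lemma skel_subset_of_le (h : J ≤ K) (r : ℕ) : J.skel r ⊆ K.skel r :=
  fun x hx => ⟨h.1 hx.1, (h.2 x hx.1).symm.trans hx.2⟩

lemma mem_skel_of_le (h : J ≤ K) {r : ℕ} {x : Set V} (hx : x ∈ K.skel r) (hJ : x ∈ J.cells) :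
    x ∈ J.skel r :=
  ⟨hJ, (h.2 x hJ).trans hx.2⟩

lemma edgesAt_subset_of_le (h : J ≤ K) (v : V) : J.edgesAt v ⊆ K.edgesAt v :=
  fun _ he => ⟨skel_subset_of_le h 1 he.1, he.2⟩

lemma skel_one_inter_edgesAt (h : J ≤ K) (v : V) : J.skel 1 ∩ K.edgesAt v = J.edgesAt v := by
  ext e
  exact ⟨fun he => ⟨he.1, he.2.2⟩, fun he => ⟨he.1, edgesAt_subset_of_le h v he⟩⟩

lemma graph_le_of_le (h : J ≤ K) : J.graph ≤ K.graph :=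
  fun _ _ hab => ⟨hab.1, skel_subset_of_le h 1 hab.2⟩

lemma eq_of_le_of_cells_eq {J' : CellComplex V} (h : J ≤ K) (h' : J' ≤ K)
    (hc : J.cells = J'.cells) : J = J' := by
  refine CellComplex.ext ?_ hc ?_
  · ext v
    rw [← singleton_mem_cells_iff, ← singleton_mem_cells_iff, hc]
  · funext x
    by_cases hx : x ∈ J.cells
    · rw [h.2 x hx, h'.2 x (hc ▸ hx)]
    · rw [J.rk_off x hx, J'.rk_off x (hc ▸ hx)]

/-- The infimum of the empty set in `ℕ` is `0`, so a nonzero `dim` certifies that some bound on the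
ranks exists. -/
lemma rk_le_dim (h : K.dim ≠ 0) {x : Set V} (hx : x ∈ K.cells) : K.rk x ≤ K.dim := by
  have hne : {R | ∀ x ∈ K.cells, K.rk x ≤ R}.Nonempty := by
    by_contra hne
    exact h (by rw [dim, Set.not_nonempty_iff_eq_empty.1 hne, Nat.sInf_empty])
  exact Nat.sInf_mem hne x hx

lemma dim_eq_of_rk_le {r : ℕ} (h : ∀ x ∈ K.cells, K.rk x ≤ r) (hr : (K.skel r).Nonempty) :
    K.dim = r := by
  obtain ⟨x, hx⟩ := hr
  refine le_antisymm (Nat.sInf_le h) ?_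
  have : K.dim ∈ {R | ∀ x ∈ K.cells, K.rk x ≤ R} := Nat.sInf_mem ⟨r, h⟩
  exact hx.2 ▸ this x hx.1

lemma IsFull.exists_cell (hK : K.IsFull) {v : V} {e f : Set V} (he : e ∈ K.edgesAt v)
    (hf : f ∈ K.edgesAt v) (hne : e ≠ f) : ∃ C ∈ K.skel 2, e ⊆ C ∧ f ⊆ C := by
  obtain ⟨C, hC, hCe⟩ := hK.2 v (mem_verts_of_mem_edgesAt he) {e, f}
    (by rintro x (rfl | rfl) <;> assumption) (Set.ncard_pair hne)
  exact ⟨C, hC, (hCe.symm ▸ (by simp) : e ∈ K.edgesAtIn v C).2,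
    (hCe.symm ▸ (by simp) : f ∈ K.edgesAtIn v C).2⟩

lemma exists_pair_edgesAtIn {C : Set V} (hC : C ∈ K.skel 2) {v : V} (hv : v ∈ C) :
    ∃ e f, e ≠ f ∧ K.edgesAtIn v C = {e, f} :=
  Set.ncard_eq_two.1 (K.ncard_edgesAtIn hC hv)

lemma eq_of_mem_edgesAtIn {C : Set V} (hC : C ∈ K.skel 2) {v : V} (hv : v ∈ C) {a e f : Set V}
    (ha : a ∈ K.edgesAtIn v C) (he : e ∈ K.edgesAtIn v C) (hf : f ∈ K.edgesAtIn v C)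
    (hea : e ≠ a) (hfa : f ≠ a) : e = f := by
  obtain ⟨b, c, -, h⟩ := exists_pair_edgesAtIn hC hv
  rw [h] at ha he hf
  simp only [Set.mem_insert_iff, Set.mem_singleton_iff] at ha he hf
  grind

/-! ### The connection -/

lemma Nabla.symm {v w : V} {e f : Set V} (h : K.Nabla v w e f) : K.Nabla w v f e := by
  obtain ⟨he, hf, h⟩ := h
  refine ⟨hf, he, ?_⟩
  rw [Set.pair_comm w v]
  rcases h with h | ⟨h1, h2, C, hC, h3, h4, h5⟩
  · exact .inl h.symm
  · exact .inr ⟨h2, h1, C, hC, h3, h5, h4⟩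

/-- Together with `Nabla.eq` this forces transport in a subcomplex to agree with transport in a full
`K`. -/
lemma Nabla.mono (h : J ≤ K) {v w : V} {e f : Set V} (hef : J.Nabla v w e f) :
    K.Nabla v w e f := by
  obtain ⟨he, hf, h'⟩ := hef
  refine ⟨edgesAt_subset_of_le h _ he, edgesAt_subset_of_le h _ hf, h'.imp_right ?_⟩
  rintro ⟨h1, h2, C, hC, h3⟩
  exact ⟨h1, h2, C, skel_subset_of_le h 2 hC, h3⟩

lemma Nabla.eq (hK : K.IsFull) {v w : V} (hvw : K.graph.Adj v w) {e f g : Set V}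
    (hf : K.Nabla v w e f) (hg : K.Nabla v w e g) : f = g :=
  (K.existsUnique_nabla hK hvw hf.1).unique hf hg

/-- The connection along an edge of a 2-cell preserves the edges in that cell. -/
lemma Nabla.mem_edgesAtIn {C : Set V} (hC : C ∈ K.skel 2) {v w : V} (h : K.graph.Adj v w)
    (hvw : {v, w} ⊆ C) {e f : Set V} (he : e ∈ K.edgesAtIn v C) (hef : K.Nabla v w e f) :
    f ∈ K.edgesAtIn w C ∧ (f = {v, w} ↔ e = {v, w}) := by
  obtain ⟨-, hf, ⟨rfl, rfl⟩ | ⟨h1, h2, D, hD, h3, h4, h5⟩⟩ := hef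
  · exact ⟨⟨hf, hvw⟩, by simp⟩
  · obtain rfl := K.eq_of_two hC hD he.1.1 h.2 h1 he.2 hvw h4 h3
    exact ⟨⟨hf, h5⟩, by simp [h1, h2]⟩

lemma nablaPath_append {u v w : V} (p : K.graph.Walk u v) (q : K.graph.Walk v w) {e g : Set V} :
    K.NablaPath (p.append q) e g ↔ ∃ f, K.NablaPath p e f ∧ K.NablaPath q f g := by
  induction p generalizing e with
  | nil => simp [NablaPath]
  | cons h p ih =>
    simp only [SimpleGraph.Walk.cons_append, NablaPath, ih]
    grind

lemma NablaPath.reverse {v w : V} {p : K.graph.Walk v w} {e f : Set V} (h : K.NablaPath p e f) :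
    K.NablaPath p.reverse f e := by
  induction p generalizing e with
  | nil => exact Eq.symm h
  | cons hvu p ih =>
    obtain ⟨g, hg, hp⟩ := h
    rw [SimpleGraph.Walk.reverse_cons, nablaPath_append]
    exact ⟨g, ih hp, e, hg.symm, rfl⟩

lemma NablaPath.mem_edgesAt {v w : V} {p : K.graph.Walk v w} {e f : Set V}
    (h : K.NablaPath p e f) (he : e ∈ K.edgesAt v) : f ∈ K.edgesAt w := by
  induction p generalizing e with
  | nil => exact h ▸ he
  | cons hvu p ih =>
    obtain ⟨g, hg, hp⟩ := h
    exact ih hp hg.2.1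

lemma NablaPath.eq (hK : K.IsFull) {v w : V} {p : K.graph.Walk v w} {e f g : Set V}
    (hf : K.NablaPath p e f) (hg : K.NablaPath p e g) : f = g := by
  induction p generalizing e with
  | nil => exact Eq.trans (Eq.symm hf) hg
  | cons hvu p ih =>
    obtain ⟨f', hf', hpf⟩ := hf
    obtain ⟨g', hg', hpg⟩ := hg
    obtain rfl := hf'.eq hK hvu hg'
    exact ih hpf hpg

lemma exists_nablaPath (hK : K.IsFull) {v w : V} (p : K.graph.Walk v w) {e : Set V}
    (he : e ∈ K.edgesAt v) : ∃ f, K.NablaPath p e f := by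
  induction p generalizing e with
  | nil => exact ⟨e, rfl⟩
  | cons hvu p ih =>
    obtain ⟨g, hg, -⟩ := K.existsUnique_nabla hK hvu he
    obtain ⟨f, hf⟩ := ih hg.2.1
    exact ⟨f, g, hg, hf⟩

lemma NablaPath.mapLe (h : J ≤ K) {v w : V} {p : J.graph.Walk v w} {e f : Set V}
    (hp : J.NablaPath p e f) : K.NablaPath (p.mapLe (graph_le_of_le h)) e f := by
  induction p generalizing e with
  | nil => exact hp
  | cons hvu p ih =>
    obtain ⟨g, hg, hp⟩ := hp
    exact ⟨g, hg.mono h, ih hp⟩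

/-! ### Connectedness of cells -/

lemma restrict_le (K : CellComplex V) (A : Set V) : K.restrict A ≤ K :=
  ⟨fun _ hx => hx.1, fun x hx => if_pos (show x ∈ K.cells ∧ x ⊆ A from hx)⟩

lemma subset_of_restrict_adj {A : Set V} {v w : V} (h : (K.restrict A).graph.Adj v w) :
    {v, w} ⊆ A :=
  h.2.1.2

lemma restrict_reachable (hK : K.IsCellConnected) {C : Set V} (hC : C ∈ K.cells) {v w : V}
    (hv : v ∈ C) (hw : w ∈ C) : (K.restrict C).graph.Reachable v w :=
  (hK.2 C hC).2 v ⟨K.cell_subset C hC hv, hv⟩ w ⟨K.cell_subset C hC hw, hw⟩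

/-- Induction over the vertices of a cell along the edges of that cell. -/
lemma IsCellConnected.induction (hK : K.IsCellConnected) {C : Set V} (hC : C ∈ K.cells)
    {v : V} (hv : v ∈ C) {P : V → Prop} (h0 : P v)
    (hstep : ∀ a b, K.graph.Adj a b → {a, b} ⊆ C → P a → P b) {w : V} (hw : w ∈ C) : P w := by
  obtain ⟨p⟩ := restrict_reachable hK hC hv hw
  clear hv hw
  induction p with
  | nil => exact h0
  | cons h p ih =>
    exact ih (hstep _ _ (graph_le_of_le (K.restrict_le C) h) (subset_of_restrict_adj h) h0)

/-- Turns the conditions on components in `IsEven` and `IsMonodromyFree` into conditions on whole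
cells. -/
lemma component_eq (hK : K.IsCellConnected) {C : Set V} (hC : C ∈ K.cells) {v : V} (hv : v ∈ C) :
    K.component C v = C := by
  apply Set.Subset.antisymm
  · rintro w ⟨p, hp⟩
    exact hp w p.end_mem_support
  · intro w hw
    refine hK.induction hC hv (P := fun w => w ∈ K.component C v) ⟨.nil, by simpa using hv⟩ ?_ hw
    rintro a b hab hC ⟨p, hp⟩
    refine ⟨p.concat hab, fun u hu => ?_⟩
    rw [SimpleGraph.Walk.support_concat] at hu
    simp only [List.mem_append, List.mem_singleton] at hu
    rcases hu with hu | rfl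
    · exact hp u hu
    · exact hC (by simp)

/-! ### Holonomy around cells -/

lemma IsCellLoop.length_eq (hK : K.IsCellConnected) {C : Set V} (hC : C ∈ K.skel 2) {v : V}
    {l : K.graph.Walk v v} (hl : K.IsCellLoop C l) : l.length = C.ncard := by
  classical
  -- The cycle visits all of `C`: at each of its vertices it already uses two edges of `C`, and
  -- there are no others, so its support is closed under adjacency in `C`.
  have hsupp : {u | u ∈ l.support} = C := by
    apply Set.Subset.antisymm hl.2
    intro w hw
    refine hK.induction hC.1 (hl.2 v l.start_mem_support) (P := fun w => w ∈ l.support)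
      l.start_mem_support ?_ hw
    intro a b hab habC ha
    have h2 := hl.1.ncard_neighborSet_toSubgraph_eq_two ha
    obtain ⟨x, y, hxy, hN⟩ := Set.ncard_eq_two.1 h2
    have key : ∀ z ∈ l.toSubgraph.neighborSet a, K.graph.Adj a z ∧ z ∈ l.support := by
      intro z hz
      exact ⟨hz.adj_sub, (l.mem_verts_toSubgraph).1 (SimpleGraph.Subgraph.Adj.snd_mem hz)⟩
    obtain ⟨hx, hxs⟩ := key x (by simp [hN])
    obtain ⟨hy, hys⟩ := key y (by simp [hN])
    have haC := hl.2 a ha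
    have hin : ∀ z, K.graph.Adj a z → z ∈ l.support → {a, z} ∈ K.edgesAtIn a C := fun z hz hzs =>
      ⟨graph_adj_mem_edgesAt_left hz, by
        rintro u (rfl | rfl)
        exacts [haC, hl.2 _ hzs]⟩
    by_cases hbx : b = x
    · exact hbx ▸ hxs
    have hpair : ∀ z z' : V, ({a, z} : Set V) = {a, z'} → z = z' := by
      intro z z' h
      have h1 : z ∈ ({a, z'} : Set V) := h ▸ (by simp)
      have h2 : z' ∈ ({a, z} : Set V) := h ▸ (by simp)
      simp only [Set.mem_insert_iff, Set.mem_singleton_iff] at h1 h2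
      grind
    have := hpair _ _ (eq_of_mem_edgesAtIn hC haC (hin x hx hxs)
      (show {a, b} ∈ K.edgesAtIn a C from ⟨graph_adj_mem_edgesAt_left hab, habC⟩) (hin y hy hys)
      (fun h => hbx (hpair _ _ h)) (fun h => hxy (hpair _ _ h).symm))
    exact this ▸ hys
  -- The base point occurs at both ends of the support; dropping the head leaves a list without
  -- repetition, as long as the cycle.
  have htail : {u | u ∈ l.support} = (l.support.tail.toFinset : Set V) := by
    ext u
    simp only [Set.mem_ofPred_eq, List.coe_toFinset]
    refine ⟨fun hu => ?_, List.mem_of_mem_tail⟩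
    rcases (SimpleGraph.Walk.mem_support_iff l).1 hu with rfl | hu
    · exact SimpleGraph.Walk.end_mem_tail_support hl.1.not_nil
    · exact hu
  rw [← hsupp, htail, Set.ncard_coe_finset, List.toFinset_card_of_nodup hl.1.support_nodup]
  simp

/-- Along a trail in a 2-cell the connection alternates between the edge just traversed and the
other edge of the cell. -/
lemma nablaPath_cons_eq_iff {C : Set V} (hC : C ∈ K.skel 2) {u u' w : V} (h : K.graph.Adj u u')
    (p : K.graph.Walk u' w) (ht : (SimpleGraph.Walk.cons h p).IsTrail)
    (hs : ∀ x ∈ (SimpleGraph.Walk.cons h p).support, x ∈ C) {e f : Set V}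
    (he : e ∈ K.edgesAtIn u C) (hef : K.NablaPath (.cons h p) e f) :
    f ∈ K.edgesAtIn w C ∧
      (f = {(SimpleGraph.Walk.cons h p).penultimate, w} ↔ (e = {u, u'} ↔ Even p.length)) := by
  have hsub : {u, u'} ⊆ C := by
    rintro x (rfl | rfl)
    · exact hs _ (by simp)
    · exact hs _ (by simp)
  induction p generalizing u e with
  | nil =>
    obtain ⟨g, hg, rfl⟩ := hef
    simpa using hg.mem_edgesAtIn hC h hsub he
  | @cons u₁ u₂ w h' p ih =>
    obtain ⟨g, hg, hp⟩ := hef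
    obtain ⟨hgC, hg'⟩ := hg.mem_edgesAtIn hC h hsub he
    rw [SimpleGraph.Walk.isTrail_cons] at ht
    have hs' : ∀ x ∈ (SimpleGraph.Walk.cons h' p).support, x ∈ C :=
      fun x hx => hs x (by rw [SimpleGraph.Walk.support_cons]; exact List.mem_cons_of_mem _ hx)
    have hsub' : {u₁, u₂} ⊆ C := by
      rintro x (rfl | rfl)
      · exact hs' _ (by simp)
      · exact hs' _ (by simp)
    have hne : ({u, u₁} : Set V) ≠ {u₁, u₂} := by
      intro heq
      apply ht.2
      have h1 : u ∈ ({u₁, u₂} : Set V) := heq ▸ (by simp)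
      rcases h1 with h1 | h1
      · exact absurd h1 h.1
      · obtain rfl : u = u₂ := h1
        simp [Sym2.eq_swap]
    -- The edges of `C` at `u₁` are the one just traversed and the next one, so every further step
    -- flips the alternative; this produces the parity of the length.
    have hiff : g = {u₁, u₂} ↔ e ≠ {u, u₁} := by
      rw [ne_eq, ← hg']
      constructor
      · rintro rfl heq
        exact hne heq.symm
      · intro hgne
        exact eq_of_mem_edgesAtIn hC (hsub (by simp)) ⟨graph_adj_mem_edgesAt_right h, hsub⟩ hgC
          ⟨graph_adj_mem_edgesAt_left h', hsub'⟩ hgne hne.symm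
    obtain ⟨hf, hf'⟩ := ih h' ht.1 hs' hgC hp hsub'
    refine ⟨hf, ?_⟩
    rw [SimpleGraph.Walk.penultimate_cons_of_not_nil _ _ (by simp), hf', hiff,
      SimpleGraph.Walk.length_cons, Nat.even_add_one]
    tauto

lemma nablaPath_cellLoop (hK : K.IsCellConnected) (he : K.IsEven) (hf : K.IsFull)
    (hm : K.IsMonodromyFree) {C : Set V} (hC : C ∈ K.skel 2) {v : V} {l : K.graph.Walk v v}
    (hl : K.IsCellLoop C l) {e : Set V} (hev : e ∈ K.edgesAt v) : K.NablaPath l e e := by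
  have hv : v ∈ C := hl.2 v l.start_mem_support
  have hcomp := component_eq hK hC.1 hv
  by_cases heC : e ⊆ C
  · obtain ⟨f, hef⟩ := exists_nablaPath hf l hev
    have hlen : Even l.length := by
      rw [hl.length_eq hK hC, ← hcomp]
      exact he C hC v hv
    have hcyc := hl.1
    have hsupp := hl.2
    have hne := hcyc.snd_ne_penultimate
    cases l with
    | nil => exact absurd hcyc SimpleGraph.Walk.not_isCycle_nil
    | @cons _ u _ h p =>
      obtain ⟨hfC, hf'⟩ := nablaPath_cons_eq_iff hC h p hcyc.isTrail hsupp ⟨hev, heC⟩ hef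
      rw [SimpleGraph.Walk.length_cons, Nat.even_add_one] at hlen
      -- The loop has even length, so `p` has odd length: `f` is the last edge of the loop exactly
      -- when `e` is not the first. Those being the two edges of `C` at `v`, it follows that `f =
      -- e`.
      simp only [hlen, iff_false] at hf'
      set z := (SimpleGraph.Walk.cons h p).penultimate with hz
      have hadj : K.graph.Adj z v := SimpleGraph.Walk.adj_penultimate (by simp)
      have hzC : z ∈ C := hsupp _ (SimpleGraph.Walk.getVert_mem_support _ _)
      have hu : u ∈ C := hsupp u (by simp)
      have hav : {v, u} ∈ K.edgesAtIn v C :=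
        ⟨graph_adj_mem_edgesAt_left h, by rintro x (rfl | rfl) <;> assumption⟩
      have hbv : {z, v} ∈ K.edgesAtIn v C :=
        ⟨graph_adj_mem_edgesAt_right hadj, by rintro x (rfl | rfl) <;> assumption⟩
      have hab : ({v, u} : Set V) ≠ {z, v} := by
        intro heq
        have h1 : u ∈ ({z, v} : Set V) := heq ▸ (by simp)
        rcases h1 with h1 | h1
        · exact hne (by simpa using h1)
        · exact h.1 (Eq.symm h1)
      have hfe : f = e := by
        by_cases hea : e = {v, u}
        · rw [hea]
          exact eq_of_mem_edgesAtIn hC hv hbv hfC hav (fun h => hf'.1 h hea) hab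
        · rw [hf'.2 hea]
          exact eq_of_mem_edgesAtIn hC hv hav hbv ⟨hev, heC⟩ hab.symm hea
      exact hfe ▸ hef
  · refine hm C hC v hv l hl e hev ?_
    rw [hcomp]
    obtain ⟨w, hvw, rfl⟩ := hK.1.exists_adj hev
    rw [Set.ncard_eq_one]
    refine ⟨v, ?_⟩
    have hw : w ∉ C := fun hw => heC (by rintro x (rfl | rfl) <;> assumption)
    ext x
    simp only [Set.mem_inter_iff, Set.mem_insert_iff, Set.mem_singleton_iff]
    grind

lemma Homotopic.nablaPath_iff (hK : K.IsCellConnected) (he : K.IsEven) (hf : K.IsFull)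
    (hm : K.IsMonodromyFree) {a b : V} {p q : K.graph.Walk a b} (h : K.Homotopic p q) {e : Set V}
    (hea : e ∈ K.edgesAt a) {f : Set V} : K.NablaPath p e f ↔ K.NablaPath q e f := by
  -- Transport is total and single-valued, so an implication between two transports is already an
  -- equivalence.
  have key : ∀ {p q : K.graph.Walk a b}, (∀ f, K.NablaPath p e f → K.NablaPath q e f) →
      ∀ f, K.NablaPath q e f → K.NablaPath p e f := by
    intro p q h f hq
    obtain ⟨g, hg⟩ := exists_nablaPath hf p hea
    exact (h g hg).eq hf hq ▸ hg
  induction h generalizing f with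
  | refl => rfl
  | symm _ _ _ ih => exact ih.symm
  | trans _ _ _ _ _ ih ih' => exact ih.trans ih'
  | rel p q h =>
    revert f
    cases h with
    | edge q₁ h q₂ =>
      have h1 : ∀ f, K.NablaPath (q₁.append q₂) e f →
          K.NablaPath (q₁.append (.cons h (.cons h.symm q₂))) e f := by
        intro f hef
        rw [nablaPath_append] at hef ⊢
        obtain ⟨g, hg, hgf⟩ := hef
        obtain ⟨k, hk, -⟩ := K.existsUnique_nabla hf h (hg.mem_edgesAt hea)
        exact ⟨g, hg, k, hk, g, hk.symm, hgf⟩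
      exact fun {f} => ⟨key h1 f, h1 f⟩
    | cell q₁ p p' q₂ C hC hp hl =>
      have h1 : ∀ f, K.NablaPath (q₁.append (p.append q₂)) e f →
          K.NablaPath (q₁.append (p'.append q₂)) e f := by
        intro f hef
        simp only [nablaPath_append] at hef ⊢
        obtain ⟨g, hg, k, hgk, hkf⟩ := hef
        -- Going along `p` and back along `p'` fixes `g`, so both paths carry `g` to the same edge.
        have hloop := nablaPath_cellLoop hK he hf hm hC hl (hg.mem_edgesAt hea)
        obtain ⟨k', hk', hk'g⟩ := (nablaPath_append _ _).1 hloop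
        obtain rfl := hgk.eq hf hk'
        have := hk'g.reverse
        rw [SimpleGraph.Walk.reverse_reverse] at this
        exact ⟨g, hg, k, this, hkf⟩
      exact fun {f} => ⟨h1 f, key h1 f⟩

lemma nablaPath_closed_eq (hK : K.IsCellConnected) (he : K.IsEven) (hf : K.IsFull)
    (hm : K.IsMonodromyFree) (hsc : K.IsSimplyConnected) {v : V} {p : K.graph.Walk v v}
    {e f : Set V} (hev : e ∈ K.edgesAt v) (h : K.NablaPath p e f) : e = f :=
  ((hsc.2 v p).nablaPath_iff hK he hf hm hev).1 h

/-! ### Lower subcomplexes -/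

/-- The cell complex of those cells of `K` that satisfy a predicate inherited by subcells. -/
noncomputable def sub (K : CellComplex V) (P : Set V → Prop)
    (hP : ∀ x y, y ⊆ x → P x → P y) : CellComplex V where
  verts := {v | v ∈ K.verts ∧ P {v}}
  cells := {x | x ∈ K.cells ∧ P x}
  rk := {x | x ∈ K.cells ∧ P x}.indicator K.rk
  finite_verts := K.finite_verts.subset fun _ hv => hv.1
  cell_subset x hx v hv := ⟨K.cell_subset x hx.1 hv, hP x _ (Set.singleton_subset_iff.2 hv) hx.2⟩
  cell_nonempty x hx := K.cell_nonempty x hx.1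
  rk_eq_zero_iff x := by
    constructor
    · rintro ⟨hx, h0⟩
      rw [Set.indicator_of_mem hx] at h0
      obtain ⟨v, hv, rfl⟩ := (K.rk_eq_zero_iff x).1 ⟨hx.1, h0⟩
      exact ⟨v, ⟨hv, hx.2⟩, rfl⟩
    · rintro ⟨v, ⟨hv, hvP⟩, rfl⟩
      have h := (K.rk_eq_zero_iff {v}).2 ⟨v, hv, rfl⟩
      exact ⟨⟨h.1, hvP⟩, by
        rw [Set.indicator_of_mem (show _ ∈ {x | x ∈ K.cells ∧ P x} from ⟨h.1, hvP⟩)]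
        exact h.2⟩
  rk_off x hx := Set.indicator_of_notMem hx _
  rk_lt x hx y hy h := by
    rw [Set.indicator_of_mem hx, Set.indicator_of_mem hy]
    exact K.rk_lt x hx.1 y hy.1 h
  inter_mem x hx y hy := (K.inter_mem x hx.1 y hy.1).imp_left
    fun h => ⟨h, hP x _ Set.inter_subset_left hx.2⟩
  exists_coface x hx y hy h := by
    obtain ⟨z, hz, hxz, hzy, hr⟩ := K.exists_coface x hx.1 y hy.1 h
    have hz' : z ∈ {x | x ∈ K.cells ∧ P x} := ⟨hz, hP y z hzy hy.2⟩
    refine ⟨z, hz', hxz, hzy, ?_⟩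
    rwa [Set.indicator_of_mem hx, Set.indicator_of_mem hz']
  diamond x hx y hy h hr := by
    rw [Set.indicator_of_mem hx, Set.indicator_of_mem hy] at hr
    rw [← K.diamond x hx.1 y hy.1 h hr, Set.indicator_of_mem hx]
    congr 1
    ext z
    constructor
    · rintro ⟨hz, h1, h2, h3⟩
      rw [Set.indicator_of_mem hz] at h3
      exact ⟨hz.1, h1, h2, h3⟩
    · rintro ⟨hz, h1, h2, h3⟩
      have hz' : z ∈ {x | x ∈ K.cells ∧ P x} := ⟨hz, hP y z h2 hy.2⟩
      exact ⟨hz', h1, h2, by rwa [Set.indicator_of_mem hz']⟩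

lemma sub_le (P : Set V → Prop) (hP : ∀ x y, y ⊆ x → P x → P y) : K.sub P hP ≤ K :=
  ⟨fun _ hx => hx.1, fun _ hx => Set.indicator_of_mem hx _⟩

/-- A subcomplex is lower if it contains every cell of `K` contained in one of its cells. -/
def IsLower (J K : CellComplex V) : Prop := ∀ x ∈ J.cells, ∀ y ∈ K.cells, y ⊆ x → y ∈ J.cells

lemma isLower_sub (P : Set V → Prop) (hP : ∀ x y, y ⊆ x → P x → P y) : (K.sub P hP).IsLower K :=
  fun x hx y hy hyx => ⟨hy, hP x y hyx hx.2⟩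

lemma isLower_restrict (A : Set V) : (K.restrict A).IsLower K :=
  fun _ hx _ hy hyx => ⟨hy, hyx.trans hx.2⟩

lemma IsLower.restrict_eq (h : J ≤ K) (hJ : J.IsLower K) {x : Set V} (hx : x ∈ J.cells) :
    J.restrict x = K.restrict x := by
  have hle : J.restrict x ≤ K := ⟨fun y hy => h.1 hy.1, fun y hy =>
    ((J.restrict_le x).2 y hy).trans (h.2 y hy.1)⟩
  refine eq_of_le_of_cells_eq hle (K.restrict_le x) ?_
  ext y
  exact ⟨fun hy => ⟨h.1 hy.1, hy.2⟩, fun hy => ⟨hJ x hx y hy.1 hy.2, hy.2⟩⟩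

lemma IsGraphBased.of_le (h : J ≤ K) (hK : K.IsGraphBased) : J.IsGraphBased :=
  fun e he => hK e (skel_subset_of_le h 1 he)

lemma IsLower.isCellConnected (h : J ≤ K) (hJ : J.IsLower K) (hK : K.IsCellConnected) :
    J.IsCellConnected :=
  ⟨hK.1.of_le h, fun x hx => hJ.restrict_eq h hx ▸ hK.2 x (h.1 hx)⟩

/-- In a lower subcomplex of a complex as in the theorem, evenness and monodromy-freeness are
inherited. -/
lemma IsLower.isInduced (h : J ≤ K) (hJ : J.IsLower K) (hdim : K.dim = 2)
    (hcc : K.IsCellConnected) (heven : K.IsEven) (hfull : K.IsFull) (hmono : K.IsMonodromyFree)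
    {v : V} {S : Set (Set V)} (hS : J.edgesAt v = S) (h2 : 2 ≤ S.ncard)
    (hreg : ∀ w ∈ J.verts, (J.edgesAt w).ncard = S.ncard)
    (hconn : ∀ w ∈ J.verts, J.graph.Reachable v w)
    (hJfull : ∀ w, ∀ e ∈ J.edgesAt w, ∀ f ∈ J.edgesAt w, e ≠ f →
      ∃ C ∈ J.skel 2, e ⊆ C ∧ f ⊆ C) : K.IsInduced v S J := by
  have hJcc := hJ.isCellConnected h hcc
  have hJc : J.IsConnected :=
    ⟨hJcc.1, fun a ha b hb => (hconn a ha).symm.trans (hconn b hb)⟩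
  have hJdim : J.dim = 2 := by
    refine dim_eq_of_rk_le (fun x hx => ?_) ?_
    · rw [h.2 x hx, ← hdim]
      exact rk_le_dim (by omega) (h.1 hx)
    · obtain ⟨e, he, f, hf, hne⟩ := (Set.one_lt_ncard (hS ▸ J.finite_edgesAt v)).1
        (show 1 < S.ncard by omega)
      obtain ⟨C, hC, -⟩ := hJfull v e (hS ▸ he) f (hS ▸ hf) hne
      exact ⟨C, hC⟩
  have hJf : J.IsFull := by
    refine ⟨hJdim.ge, fun w hw T hT hT2 => ?_⟩
    obtain ⟨e, f, hne, rfl⟩ := Set.ncard_eq_two.1 hT2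
    have he : e ∈ J.edgesAt w := hT (by simp)
    have hf : f ∈ J.edgesAt w := hT (by simp)
    obtain ⟨C, hC, heC, hfC⟩ := hJfull w e he f hf hne
    -- A 2-cell has only two edges at `w`, so containing `e` and `f` leaves no room for others.
    refine ⟨C, hC, (Set.eq_of_subset_of_ncard_le ?_ ?_
      ((J.finite_edgesAt w).subset fun e he => he.1)).symm⟩
    · rintro x (rfl | rfl)
      exacts [⟨he, heC⟩, ⟨hf, hfC⟩]
    · rw [J.ncard_edgesAtIn hC (heC he.2), hT2]
  refine ⟨h, hJdim, ⟨hJcc.1, hreg⟩, ⟨hJc, hJcc⟩, ?_, hJf, ?_, hJc, ?_⟩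
  · intro C hC w hw
    have hCK := skel_subset_of_le h 2 hC
    rw [component_eq hJcc hC.1 hw, ← component_eq hcc hCK.1 hw]
    exact heven C hCK w hw
  · intro C hC w hw l hl e he _
    obtain ⟨f, hf⟩ := exists_nablaPath hJf l he
    have hl' : K.IsCellLoop C (l.mapLe (graph_le_of_le h)) :=
      ⟨hl.1.mapLe _, by simpa using hl.2⟩
    have := nablaPath_cellLoop hcc heven hfull hmono (skel_subset_of_le h 2 hC) hl'
      (edgesAt_subset_of_le h w he)
    exact (hf.mapLe h).eq hfull this ▸ hf
  · rw [skel_one_inter_edgesAt h, hS]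

lemma isInduced_restrict (hdim : K.dim = 2) (hcc : K.IsCellConnected) (heven : K.IsEven)
    (hfull : K.IsFull) (hmono : K.IsMonodromyFree) {C : Set V} (hC : C ∈ K.skel 2) {v : V}
    (hv : v ∈ C) : K.IsInduced v (K.edgesAtIn v C) (K.restrict C) := by
  have hle := K.restrict_le C
  have hCr : C ∈ (K.restrict C).skel 2 := mem_skel_of_le hle hC ⟨hC.1, subset_rfl⟩
  have hedges : ∀ w, (K.restrict C).edgesAt w = K.edgesAtIn w C := by
    intro w
    ext e
    exact ⟨fun he => ⟨edgesAt_subset_of_le hle w he, he.1.1.2⟩,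
      fun he => ⟨mem_skel_of_le hle he.1.1 ⟨he.1.1.1, he.2⟩, he.1.2⟩⟩
  have hcard := K.ncard_edgesAtIn hC hv
  refine (isLower_restrict C).isInduced hle hdim hcc heven hfull hmono (hedges v) hcard.ge ?_ ?_ ?_
  · intro w hw
    rw [hedges, hcard, K.ncard_edgesAtIn hC hw.2]
  · exact fun w hw => restrict_reachable hcc hC.1 hv hw.2
  · exact fun w e he f hf _ => ⟨C, hCr, he.1.1.2, hf.1.1.2⟩

/-! ### Comparison of induced subcomplexes -/

lemma IsInduced.edgesAt_eq {v : V} {S : Set (Set V)} (h : K.IsInduced v S J) :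
    J.edgesAt v = S := by
  obtain ⟨hle, -, -, -, -, -, -, -, hS⟩ := h
  rw [← skel_one_inter_edgesAt hle, hS]

/-- A connected full subcomplex of rank two is contained in any full subcomplex that contains
its edges at one of its vertices. -/
lemma cells_subset_of_edgesAt_subset {J' : CellComplex V} (hK : K.IsFull) (h : J ≤ K)
    (h' : J' ≤ K) (hdim : J.dim = 2) (hc : J.IsConnected) (hf : J.IsFull) (hf' : J'.IsFull)
    {v : V} (hv : v ∈ J.verts) (hv' : v ∈ J'.verts) (hS : J.edgesAt v ⊆ J'.edgesAt v) :
    J.cells ⊆ J'.cells := by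
  have key : ∀ w ∈ J.verts, w ∈ J'.verts ∧ J.edgesAt w ⊆ J'.edgesAt w := by
    intro w hw
    obtain ⟨p⟩ := hc.2 v hv w hw
    clear hv hw
    induction p with
    | nil => exact ⟨hv', hS⟩
    | @cons a b w hab p ih =>
      have hab' : J'.graph.Adj a b :=
        ⟨hab.1, (hS (graph_adj_mem_edgesAt_left hab)).1⟩
      have habK := graph_le_of_le h hab
      refine ih (mem_verts_of_mem_edgesAt (graph_adj_mem_edgesAt_right hab')) ?_
      intro g hg
      -- Pull `g` back to `a` within `J`, where its image lies in `J'` too, then push forward within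
      -- `J'`; both transports are those of `K`, so the result is `g`.
      obtain ⟨f, hgf, -⟩ := J.existsUnique_nabla hf hab.symm hg
      obtain ⟨g', hg', -⟩ := J'.existsUnique_nabla hf' hab' (hS hgf.2.1)
      exact (hg'.mono h').eq hK habK (hgf.symm.mono h) ▸ hg'.2.1
  intro x hx
  have hr : J.rk x ≤ 2 := hdim ▸ rk_le_dim (by omega) hx
  obtain ⟨w, hw⟩ := J.cell_nonempty x hx
  have hwJ := J.cell_subset x hx hw
  interval_cases hrx : J.rk x
  · obtain ⟨u, hu, rfl⟩ := (J.rk_eq_zero_iff x).1 ⟨hx, hrx⟩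
    exact singleton_mem_cells_iff.2 (key u hu).1
  · exact ((key w hwJ).2 ⟨⟨hx, hrx⟩, hw⟩).1.1
  -- Two edges of the 2-cell `x` at `w` lie in `J'`, hence in a 2-cell of `J'`, which must be `x`
  -- because two edges determine a 2-cell of `K`.
  · obtain ⟨e, f, hne, hef⟩ := exists_pair_edgesAtIn ⟨hx, hrx⟩ hw
    have he : e ∈ J.edgesAtIn w x := by simp [hef]
    have hf : f ∈ J.edgesAtIn w x := by simp [hef]
    have he' := (key w hwJ).2 he.1
    have hf'' := (key w hwJ).2 hf.1
    obtain ⟨D, hD, heD, hfD⟩ := hf'.exists_cell he' hf'' hne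
    obtain rfl := K.eq_of_two (skel_subset_of_le h 2 ⟨hx, hrx⟩) (skel_subset_of_le h' 2 hD)
      (skel_subset_of_le h 1 he.1.1) (skel_subset_of_le h 1 hf.1.1) hne he.2 hf.2 heD hfD
    exact hD.1

lemma IsInduced.le {J' : CellComplex V} (hK : K.IsFull) {v : V} {S S' : Set (Set V)}
    (h : K.IsInduced v S J) (h' : K.IsInduced v S' J') (hne : S.Nonempty) (hS : S ⊆ S') :
    J ≤ J' := by
  have hE := h.edgesAt_eq
  have hE' := h'.edgesAt_eq
  obtain ⟨hle, hdim, -, -, -, hf, -, hc, -⟩ := h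
  obtain ⟨hle', -, -, -, -, hf', -, -, -⟩ := h'
  obtain ⟨e, he⟩ := hne
  have hsub := cells_subset_of_edgesAt_subset hK hle hle' hdim hc hf hf'
    (mem_verts_of_mem_edgesAt (hE ▸ he)) (mem_verts_of_mem_edgesAt (hE' ▸ hS he))
    (by rw [hE, hE']; exact hS)
  exact ⟨hsub, fun x hx => (hle.2 x hx).trans (hle'.2 x (hsub hx)).symm⟩

lemma IsInduced.eq {J' : CellComplex V} (hK : K.IsFull) {v : V} {S : Set (Set V)}
    (h : K.IsInduced v S J) (h' : K.IsInduced v S J') (hne : S.Nonempty) : J = J' :=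
  eq_of_le_of_cells_eq h.1 h'.1
    ((h.le hK h' hne subset_rfl).1.antisymm (h'.le hK h hne subset_rfl).1)

/-- The induced subcomplex is induced at each of its vertices. -/
lemma IsInduced.of_mem_verts {v w : V} {S : Set (Set V)} (h : K.IsInduced v S J)
    (hw : w ∈ J.verts) : K.IsInduced w (J.edgesAt w) J := by
  obtain ⟨hle, hdim, hreg, hl, he, hf, hm, hc, -⟩ := h
  exact ⟨hle, hdim, ⟨hreg.1, fun u hu => (hreg.2 u hu).trans (hreg.2 w hw).symm⟩, hl, he, hf, hm,
    hc, skel_one_inter_edgesAt hle w⟩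

/-! ### Existence of induced subcomplexes -/

/-- The edges at `w` obtained from the edges in `S` by transport along paths from `v` to `w`. -/
def transported (K : CellComplex V) (v : V) (S : Set (Set V)) (w : V) : Set (Set V) :=
  {f | ∃ p : K.graph.Walk v w, ∃ e ∈ S, K.NablaPath p e f}

/-- Extending the path by one edge suffices, because `transported` allows all paths; path
independence is needed only to control the size of the sets. -/
lemma mem_transported_iff_of_nabla {v : V} {S : Set (Set V)} {a b : V} (hab : K.graph.Adj a b)
    {e f : Set V} (h : K.Nabla a b e f) :
    e ∈ K.transported v S a ↔ f ∈ K.transported v S b := by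
  have key : ∀ {a b : V} {e f : Set V}, K.graph.Adj a b → K.Nabla a b e f →
      e ∈ K.transported v S a → f ∈ K.transported v S b := by
    rintro a b e f hab h ⟨p, g, hg, hge⟩
    exact ⟨p.append (.cons hab .nil), g, hg,
      (nablaPath_append p (.cons hab .nil)).2 ⟨e, hge, f, h, rfl⟩⟩
  exact ⟨key hab h, key hab.symm h.symm⟩

lemma pair_mem_transported_iff {v : V} {S : Set (Set V)} {a b : V} (hab : K.graph.Adj a b) :
    {a, b} ∈ K.transported v S a ↔ {a, b} ∈ K.transported v S b :=
  mem_transported_iff_of_nabla hab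
    ⟨graph_adj_mem_edgesAt_left hab, graph_adj_mem_edgesAt_right hab, .inl ⟨rfl, rfl⟩⟩

lemma transported_subset {v : V} {S : Set (Set V)} (hS : S ⊆ K.edgesAt v) (w : V) :
    K.transported v S w ⊆ K.edgesAt w := by
  rintro f ⟨p, e, he, hef⟩
  exact hef.mem_edgesAt (hS he)

lemma transported_self (hcc : K.IsCellConnected) (heven : K.IsEven) (hfull : K.IsFull)
    (hmono : K.IsMonodromyFree) (hsc : K.IsSimplyConnected) {v : V} {S : Set (Set V)}
    (hS : S ⊆ K.edgesAt v) : K.transported v S v = S := by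
  ext e
  constructor
  · rintro ⟨p, f, hf, hfe⟩
    exact nablaPath_closed_eq hcc heven hfull hmono hsc (hS hf) hfe ▸ hf
  · exact fun he => ⟨.nil, e, he, rfl⟩

/-- Transport along one fixed path `q` is a bijection from `S`: it is injective by reversal, and
surjective since any other path `p` closes up with `q` to a loop with trivial transport. -/
lemma ncard_transported (hcc : K.IsCellConnected) (heven : K.IsEven) (hfull : K.IsFull)
    (hmono : K.IsMonodromyFree) (hsc : K.IsSimplyConnected) {v : V} {S : Set (Set V)}
    (hS : S ⊆ K.edgesAt v) {w : V} (h : K.graph.Reachable v w) :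
    (K.transported v S w).ncard = S.ncard := by
  obtain ⟨q⟩ := h
  choose F hF using fun e (he : e ∈ S) => exists_nablaPath hfull q (hS he)
  refine (Set.ncard_congr (t := K.transported v S w) F (fun e he => ⟨q, e, he, hF e he⟩) ?_ ?_).symm
  · intro e e' he he' heq
    exact (hF e he).reverse.eq hfull (heq ▸ (hF e' he').reverse)
  · rintro f ⟨p, e, he, hef⟩
    refine ⟨e, he, ?_⟩
    have := nablaPath_closed_eq hcc heven hfull hmono hsc (hef.mem_edgesAt (hS he))
      ((nablaPath_append p.reverse q).2 ⟨e, hef.reverse, hF e he⟩)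
    exact this.symm

/-- The graph formed by the transported edges. -/
def transportGraph (K : CellComplex V) (v : V) (S : Set (Set V)) : SimpleGraph V where
  Adj a b := K.graph.Adj a b ∧ {a, b} ∈ K.transported v S a
  symm := ⟨fun a b h => ⟨h.1.symm, by
    rw [Set.pair_comm]
    exact (pair_mem_transported_iff h.1).1 h.2⟩⟩
  loopless := ⟨fun _ h => h.1.ne rfl⟩

/-- The subcomplex spanned by the edges in `S` at `v`: its cells are those that are reachable from
`v` through transported edges and all of whose edges are transported. -/
noncomputable def span (K : CellComplex V) (v : V) (S : Set (Set V)) : CellComplex V :=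
  K.sub (fun x => ∀ u ∈ x, (K.transportGraph v S).Reachable v u ∧
    K.edgesAtIn u x ⊆ K.transported v S u)
    fun _ _ hyx hx u hu => ⟨(hx u (hyx hu)).1, fun _ he =>
      (hx u (hyx hu)).2 ⟨he.1, he.2.trans hyx⟩⟩

lemma mem_verts_span {v w : V} {S : Set (Set V)} :
    w ∈ (K.span v S).verts ↔ w ∈ K.verts ∧ (K.transportGraph v S).Reachable v w := by
  constructor
  · exact fun hw => ⟨hw.1, (hw.2 w rfl).1⟩
  · rintro ⟨hw, hr⟩
    refine ⟨hw, ?_⟩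
    rintro u rfl
    refine ⟨hr, fun e he => ?_⟩
    -- The condition on edges is vacuous for a singleton: it has rank 0 and contains no edge.
    have hlt := K.rk_eq_zero_iff {u} |>.2 ⟨u, hw, rfl⟩
    rcases Set.subset_singleton_iff_eq.1 he.2 with h | h
    · exact absurd he.1.2 (by simp [h])
    · have := he.1.1.2
      rw [h, hlt.2] at this
      omega

/-- The only edge inside an edge is itself, and being transported does not depend on which of its
endpoints is considered. -/
lemma edgesAt_span (hg : K.IsGraphBased) {v w : V} {S : Set (Set V)} (hS : S ⊆ K.edgesAt v)
    (hw : (K.transportGraph v S).Reachable v w) :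
    (K.span v S).edgesAt w = K.transported v S w := by
  ext e
  constructor
  · intro he
    exact (he.1.1.2 w he.2).2 ⟨edgesAt_subset_of_le (sub_le _ _) w he, subset_rfl⟩
  · intro he
    have heK := transported_subset hS w he
    obtain ⟨u, hwu, rfl⟩ := hg.exists_adj heK
    have hu : (K.transportGraph v S).Reachable v u :=
      hw.trans (SimpleGraph.Adj.reachable ⟨hwu, he⟩)
    refine ⟨mem_skel_of_le (sub_le _ _) heK.1 ⟨heK.1.1, ?_⟩, heK.2⟩
    rintro x (rfl | rfl)
    · refine ⟨hw, fun f hf => ?_⟩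
      rwa [skel_one_eq_of_subset hf.1.1 heK.1 hf.2]
    · refine ⟨hu, fun f hf => ?_⟩
      rw [skel_one_eq_of_subset hf.1.1 heK.1 hf.2]
      exact (pair_mem_transported_iff hwu).1 he

/-- A 2-cell with two transported edges at one vertex belongs to the spanned subcomplex. -/
lemma mem_span_of_edgesAtIn_subset (hcc : K.IsCellConnected) (hfull : K.IsFull) {v w : V}
    {S : Set (Set V)} (hw : (K.transportGraph v S).Reachable v w) {C : Set V}
    (hC : C ∈ K.skel 2) (hwC : w ∈ C) (h : K.edgesAtIn w C ⊆ K.transported v S w) :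
    C ∈ (K.span v S).skel 2 := by
  refine mem_skel_of_le (sub_le _ _) hC ⟨hC.1, fun u hu => ?_⟩
  refine hcc.induction hC.1 hwC (P := fun u => (K.transportGraph v S).Reachable v u ∧
    K.edgesAtIn u C ⊆ K.transported v S u) ⟨hw, h⟩ ?_ hu
  rintro a b hab habC ⟨hra, ha⟩
  have habt : {a, b} ∈ K.transported v S a := ha ⟨graph_adj_mem_edgesAt_left hab, habC⟩
  refine ⟨hra.trans (SimpleGraph.Adj.reachable ⟨hab, habt⟩), fun g hg => ?_⟩
  -- The pullback of `g` to `a` is again an edge of `C`, hence transported there.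
  obtain ⟨f, hf, -⟩ := K.existsUnique_nabla hfull hab.symm hg.1
  rw [← mem_transported_iff_of_nabla hab hf.symm]
  exact ha (hf.mem_edgesAtIn hC hab.symm (Set.pair_comm a b ▸ habC) hg).1

theorem isInduced_span (hdim : K.dim = 2) (hcc : K.IsCellConnected) (heven : K.IsEven)
    (hfull : K.IsFull) (hmono : K.IsMonodromyFree) (hsc : K.IsSimplyConnected) {v : V}
    {S : Set (Set V)} (hS : S ⊆ K.edgesAt v) (h2 : 2 ≤ S.ncard) :
    K.IsInduced v S (K.span v S) := by
  have hreach : ∀ w, (K.transportGraph v S).Reachable v w → K.graph.Reachable v w :=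
    fun w hw => hw.mono fun _ _ h => And.left h
  refine (isLower_sub _ _).isInduced (sub_le _ _) hdim hcc heven hfull hmono ?_ h2 ?_ ?_ ?_
  · exact (edgesAt_span hcc.1 hS .rfl).trans (transported_self hcc heven hfull hmono hsc hS)
  · intro w hw
    have hr := (mem_verts_span.1 hw).2
    exact (congrArg Set.ncard (edgesAt_span hcc.1 hS hr)).trans
      (ncard_transported hcc heven hfull hmono hsc hS (hreach w hr))
  · intro w hw
    have hr := (mem_verts_span.1 hw).2
    have hr' := (SimpleGraph.reachable_iff_reflTransGen _ _).1 hr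
    clear hw hr
    induction hr' with
    | refl => exact .rfl
    | @tail a b hva hab ih =>
      have ha := (SimpleGraph.reachable_iff_reflTransGen _ _).2 hva
      refine ih.trans (SimpleGraph.Adj.reachable ⟨hab.1.1, ?_⟩)
      have : {a, b} ∈ (K.span v S).edgesAt a := by
        rw [edgesAt_span hcc.1 hS ha]
        exact hab.2
      exact this.1
  · intro w e he f hf hne
    have hr := (mem_verts_span.1 (mem_verts_of_mem_edgesAt he)).2
    have he' := edgesAt_subset_of_le (sub_le _ _) w he
    have hf' := edgesAt_subset_of_le (sub_le _ _) w hf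
    obtain ⟨C, hC, hCe⟩ := hfull.2 w (mem_verts_of_mem_edgesAt he') {e, f}
      (by rintro x (rfl | rfl) <;> assumption) (Set.ncard_pair hne)
    have heC : e ⊆ C := (hCe.symm ▸ (by simp) : e ∈ K.edgesAtIn w C).2
    have hfC : f ⊆ C := (hCe.symm ▸ (by simp) : f ∈ K.edgesAtIn w C).2
    refine ⟨C, mem_span_of_edgesAtIn_subset hcc hfull hr hC (heC he.2) ?_, heC, hfC⟩
    rw [hCe, ← edgesAt_span hcc.1 hS hr]
    rintro x (rfl | rfl)
    exacts [he, hf]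

end CellComplex

/-! ### The main theorem -/

open CellComplex in
theorem mainTheorem4 {V : Type*} (K : CellComplex V) (hdim : K.dim = 2) (hlocal : K.IsLocal)
    (heven : K.IsEven) (hfull : K.IsFull) (hmono : K.IsMonodromyFree)
    (hsc : K.IsSimplyConnected) :
    ∃ J : V → Set (Set V) → CellComplex V,
      (∀ v S, K.Admissible v S →
        K.IsInduced v S (J v S) ∧ ∀ J', K.IsInduced v S J' → J' = J v S) ∧
      (∀ v S v' S', K.Admissible v S → K.Admissible v' S' →
        (J v S = J v' S' ↔ v' ∈ (J v S).verts ∧ S' = (J v S).skel 1 ∩ K.edgesAt v')) ∧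
      (∀ v S S', K.Admissible v S → K.Admissible v S' →
        (S ⊂ S' ↔ J v S ≤ J v S' ∧ J v S ≠ J v S')) ∧
      (∀ v S, K.Admissible v S → S.ncard = 2 →
        ∃ C ∈ K.skel 2, S = K.edgesAtIn v C ∧ J v S = K.restrict C) := by
  have hcc := hlocal.2
  have hind : ∀ v S, K.Admissible v S → K.IsInduced v S (K.span v S) := fun v S h =>
    isInduced_span hdim hcc heven hfull hmono hsc h.2.1.subset h.2.2
  have hne : ∀ v S, K.Admissible v S → S.Nonempty := fun v S h =>
    Set.nonempty_of_ncard_ne_zero (by have := h.2.2; omega)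
  have huniq : ∀ v S, K.Admissible v S → ∀ J', K.IsInduced v S J' → J' = K.span v S :=
    fun v S h J' hJ' => hJ'.eq hfull (hind v S h) (hne v S h)
  refine ⟨K.span, fun v S h => ⟨hind v S h, huniq v S h⟩, ?_, ?_, ?_⟩
  · intro v S v' S' h h'
    have hi := hind v S h
    have hi' := hind v' S' h'
    rw [skel_one_inter_edgesAt hi.1]
    constructor
    · intro heq
      rw [heq]
      obtain ⟨e, he⟩ := hne v' S' h'
      have hE := hi'.edgesAt_eq
      exact ⟨mem_verts_of_mem_edgesAt (hE ▸ he), hE.symm⟩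
    · rintro ⟨hv', rfl⟩
      -- The complex spanned at `v` is also induced by its own edges at `v'`, so uniqueness at `v'`
      -- identifies the two.
      exact huniq v' _ h' _ (hi.of_mem_verts hv')
  · intro v S S' h h'
    have hi := hind v S h
    have hi' := hind v S' h'
    constructor
    · intro hSS
      refine ⟨hi.le hfull hi' (hne v S h) hSS.subset, fun heq => hSS.ne ?_⟩
      rw [← hi.edgesAt_eq, ← hi'.edgesAt_eq, heq]
    · rintro ⟨hle, hneq⟩
      refine LE.le.ssubset_of_ne ?_ fun heq => hneq (by rw [heq])
      rw [← hi.edgesAt_eq, ← hi'.edgesAt_eq]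
      exact edgesAt_subset_of_le hle v
  · intro v S h h2
    obtain ⟨C, hC, hCS⟩ := hfull.2 v h.1 S h.2.1.subset h2
    obtain ⟨e, he⟩ := hne v S h
    have heC : e ∈ K.edgesAtIn v C := hCS ▸ he
    -- The restriction to the 2-cell through the two edges is itself induced by them.
    refine ⟨C, hC, hCS.symm, (huniq v S h _ ?_).symm⟩
    rw [← hCS]
    exact isInduced_restrict hdim hcc heven hfull hmono hC (heC.2 heC.1.2)
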